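/- **Model.** There are $n$ items $1,\dots,n$ with real values $x_1,\dots,x_n$ that are unknown to the algorithm. A comparison of items $i$ and $j$ reports one of the two as the larger one. If $|x_i-x_j|>1$, the item with the larger value is reported; otherwise an adaptive adversary chooses the answer. The algorithm works in rounds: in each round it submits a finite batch of comparisons in parallel and then receives all their answers. The adversary knows the values and the algorithm. Its answers may depend on all earlier queries and answers and on all queries of the current round, but not on random choices that the algorithm has not yet revealed through its queries; it need not answer a repeated comparison consistently. A randomized algorithm is given, for each $n$, by a finite-depth decision tree, which may also make uniformly random choices from finite sets and which finally returns an ordering of the items. An ordering $\sigma(1),\dots,\sigma(n)$ of the items is a *$4$-approximate sorting* if $x_{\sigma(q)}\ge x_{\sigma(p)}-4$ for all $p<q$, that is, any two items in the wrong order differ in value by at most $4$. **Theorem 1.1.** There are a randomized algorithm and a constant $C>0$ such that for every $n\ge 1$: 1. the algorithm on $n$ items makes at most $C\,n\log^2 n$ comparisons in at most $C\log n$ rounds, whatever its random choices and the answers are; 2. for all values $x_1,\dots,x_n\in\mathbb R$ and every adaptive adversary, the returned ordering is a $4$-approximate sorting with probability greater than $1-\frac1{n^2}$, where the probability is over the random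 choices of the algorithm. -/

import Mathlib

namespace AdvSort

/-- `a` is at least `b` up to an error of `k`. -/
def GeApprox (k a b : ℝ) : Prop := b - k ≤ a

/-- The item `σ p` is placed at position `p`. The ordering `σ` of the items with values `x` is a
`k`-approximate sorting if whenever `p < q`, the item at position `q` is, up to `k`, at least the
item at position `p`. -/
def IsApproxSorting {n : ℕ} (k : ℝ) (x : Fin n → ℝ) (σ : Equiv.Perm (Fin n)) : Prop :=
  ∀ p q : Fin n, p < q → GeApprox k (x (σ q)) (x (σ p))

/-- A randomized comparison algorithm that orders `n` items, as a decision tree that works in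
rounds. It never sees the values of the items.
* `output σ` stops and returns the ordering `σ`;
* `random m next` draws a uniformly random element of `Fin (m + 1)` and continues with it;
* `round k query next` submits the `k` comparisons `query 0, …, query (k - 1)` in parallel and
  continues with their answers; the answer `true` to `(i, j)` says that `i` is the larger item,
  the answer `false` that `j` is. -/
inductive SortAlg (n : ℕ) : Type
  | output (σ : Equiv.Perm (Fin n)) : SortAlg n
  | random (m : ℕ) (next : Fin (m + 1) → SortAlg n) : SortAlg n
  | round (k : ℕ) (query : Fin k → Fin n × Fin n) (next : (Fin k → Bool) → SortAlg n) : SortAlg n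

namespace SortAlg

/-- The largest number of comparisons on any branch, that is, for any outcome of the random draws
and any answers. -/
def maxComparisons {n : ℕ} : SortAlg n → ℕ
  | output _ => 0
  | random _ next => Finset.univ.sup fun r => maxComparisons (next r)
  | round k _ next => k + Finset.univ.sup fun a => maxComparisons (next a)

/-- The largest number of rounds of comparisons on any branch. -/
def maxRounds {n : ℕ} : SortAlg n → ℕ
  | output _ => 0
  | random _ next => Finset.univ.sup fun r => maxRounds (next r)
  | round _ _ next => 1 + Finset.univ.sup fun a => maxRounds (next a)

end SortAlg

/-- The record of a completed round: the comparisons that were asked and their answers. -/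
structure RoundRecord (n : ℕ) : Type where
  size : ℕ
  query : Fin size → Fin n × Fin n
  answer : Fin size → Bool

/-- A strategy for answering comparisons adaptively: the answers in a round may depend on all
queries and answers of the earlier rounds (listed from first to last) and on all queries of the
current round. Nothing forces it to answer a repeated comparison in the same way. -/
def Strategy (n : ℕ) : Type :=
  List (RoundRecord n) → (k : ℕ) → (Fin k → Fin n × Fin n) → (Fin k → Bool)

/-- The strategy is an adversarial comparator for the values `x`: the larger item is reported
whenever the two values differ by more than `1`; all other answers are arbitrary. -/
def Strategy.IsAdversarialComparator {n : ℕ} (A : Strategy n) (x : Fin n → ℝ) : Prop :=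
  ∀ (h : List (RoundRecord n)) (k : ℕ) (query : Fin k → Fin n × Fin n) (t : Fin k),
    (1 < x (query t).1 - x (query t).2 → A h k query t = true) ∧
    (1 < x (query t).2 - x (query t).1 → A h k query t = false)

/-- The distribution of the returned ordering when the algorithm is run against the strategy `A`,
starting after the rounds recorded in the list. -/
noncomputable def SortAlg.run {n : ℕ} (A : Strategy n) :
    SortAlg n → List (RoundRecord n) → PMF (Equiv.Perm (Fin n))
  | .output σ, _ => PMF.pure σ
  | .random m next, h =>
      (PMF.uniformOfFintype (Fin (m + 1))).bind fun r => SortAlg.run A (next r) h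
  | .round k query next, h =>
      SortAlg.run A (next (A h k query)) (h ++ [⟨k, query, A h k query⟩])

/-- The probability that the algorithm, run from the start against the strategy `A`, returns a
`k`-approximate sorting of the items with values `x`. -/
noncomputable def SortAlg.successProb {n : ℕ} (alg : SortAlg n) (A : Strategy n) (k : ℝ)
    (x : Fin n → ℝ) : ℝ :=
  ((alg.run A []).toOuterMeasure {σ | IsApproxSorting k x σ}).toReal

end AdvSort

/-!
The algorithm is a quicksort by levels. It keeps an ordered partition of the items into blocks and
cuts all blocks in parallel, with one round of `O(log n)` comparisons per item; each part of a cut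
has at most `29/30` of its block, so that `O(log n)` levels suffice. Errors do not accumulate: two
items are separated only once, so it is enough that every cut is correct up to `4`.

In each block, all items are compared with `K = O(log n)` random pivots. If `x a > x b + 2`, then
`a` beats every pivot that `b` beats, so a cut by the number of beaten pivots is correct up to `2`
for any answers. The adversary can prevent a balanced cut of this kind by letting almost all items
beat the same number of pivots, for instance if there are two distant clusters of equal items and
all items win against pivots of their own cluster in the lower one and lose in the upper one.

So the block is compared along a random graph as well, with `K` uniform pairs per item. Both ends
of an edge play the same role, so within a set of items there are as many wins as losses. Suppose
that `x a > x b + 4` and that `a` and `b` beat the same pivots, at least half of them. Then the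
pivots show that almost no items lie between `b` and `a`, and at least about half of the items
below. The item `a` wins against all of these, but on the average they win only half of their
comparisons with each other and none against the upper items. Hence `a` is not among the items with
the fewest wins, and it is safe to cut these off (`bad_of_misplaced`). If less than half of the
pivots are beaten, the items with the fewest losses are cut off instead.

All that is used about the draws is that a few counts are close to their means. The counts do not
depend on the answers, so Chernoff's bound (`card_le_exp_mul_card`) and a union bound over the pairs
`a`, `b` hold against every adaptive adversary (`card_exists_bad_le`), and the error probabilities of
the levels add up (`run_sortLevels_le`).
-/

namespace AdvSort

/-! ### A Chernoff bound -/

/-- Chernoff's bound in counting form. For `ω` uniform in a finite product, the number `X` of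
indices `i` with `P i (ω i)` is a sum of independent indicators, so `exp (l * (X - u))` has mean at
most `exp (-(l * u) + (exp l - 1) * μ)` with `μ` the mean of `X`. A positive `l` bounds the upper
tail `u ≤ X`, a negative `l` the lower tail `X ≤ u`. -/
theorem card_le_exp_mul_card {ι : Type*} [Fintype ι] [DecidableEq ι] {κ : ι → Type*}
    [∀ i, Fintype (κ i)] [∀ i, Nonempty (κ i)] (P : ∀ i, κ i → Prop)
    [∀ i, DecidablePred (P i)] (l u : ℝ) (T : Finset (∀ i, κ i))
    (hT : ∀ ω ∈ T, l * u ≤ l * (Finset.univ.filter fun i => P i (ω i)).card) :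
    (T.card : ℝ) ≤ Real.exp (-(l * u) + (Real.exp l - 1) *
      ∑ i, ((Finset.univ.filter (P i)).card : ℝ) / Fintype.card (κ i)) *
      Fintype.card (∀ i, κ i) := by
  have h1 : (T.card : ℝ) ≤ ∑ ω : ∀ i, κ i,
      Real.exp (-(l * u)) * ∏ i, (if P i (ω i) then Real.exp l else 1) := by
    have h2 : (T.card : ℝ) = ∑ ω ∈ T, (1 : ℝ) := by simp
    rw [h2]
    refine le_trans (Finset.sum_le_sum fun ω hω => ?_)
      (Finset.sum_le_sum_of_subset_of_nonneg (Finset.subset_univ T) fun ω _ _ => ?_)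
    · rw [Finset.prod_ite, Finset.prod_const, Finset.prod_const_one, mul_one, ← Real.exp_nat_mul,
        ← Real.exp_add]
      apply Real.one_le_exp
      have := hT ω hω
      linarith
    · refine mul_nonneg (Real.exp_nonneg _) (Finset.prod_nonneg fun i _ => ?_)
      split_ifs
      · exact Real.exp_nonneg _
      · exact zero_le_one
  refine h1.trans ?_
  have h3 : ∀ i, ∑ k : κ i, (if P i k then Real.exp l else 1) ≤
      Real.exp ((Real.exp l - 1) * (((Finset.univ.filter (P i)).card : ℝ) /
        Fintype.card (κ i))) * Fintype.card (κ i) := by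
    intro i
    have hc : (0 : ℝ) < Fintype.card (κ i) := by exact_mod_cast Fintype.card_pos
    have h4 : ∑ k : κ i, (if P i k then Real.exp l else 1) =
        ((Real.exp l - 1) * (((Finset.univ.filter (P i)).card : ℝ) /
        Fintype.card (κ i)) + 1) * Fintype.card (κ i) := by
      have h5 : ∀ k : κ i, (if P i k then Real.exp l else 1) =
          (Real.exp l - 1) * (if P i k then 1 else 0) + 1 := by
        intro k; split_ifs <;> ring
      rw [Finset.sum_congr rfl fun k _ => h5 k, Finset.sum_add_distrib, ← Finset.mul_sum,
        Finset.sum_boole]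
      simp only [Finset.sum_const, Finset.card_univ, nsmul_eq_mul, mul_one]
      field_simp
    rw [h4]
    exact mul_le_mul_of_nonneg_right (Real.add_one_le_exp _) hc.le
  rw [← Finset.mul_sum, ← Fintype.prod_sum (fun i k => if P i k then Real.exp l else 1)]
  have h6 : ∏ i, ∑ k : κ i, (if P i k then Real.exp l else 1) ≤
      ∏ i, (Real.exp ((Real.exp l - 1) * (((Finset.univ.filter (P i)).card : ℝ) /
        Fintype.card (κ i))) * Fintype.card (κ i)) := by
    refine Finset.prod_le_prod (fun i _ => Finset.sum_nonneg fun k _ => ?_) fun i _ => h3 i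
    split_ifs
    · exact Real.exp_nonneg _
    · exact zero_le_one
  refine (mul_le_mul_of_nonneg_left h6 (Real.exp_nonneg _)).trans (le_of_eq ?_)
  rw [Finset.prod_mul_distrib, ← Real.exp_sum, ← Finset.mul_sum, Fintype.card_pi, Nat.cast_prod,
    Real.exp_add]
  ring

theorem exp_sub_one_le {l : ℝ} (h : |l| ≤ 1) : Real.exp l - 1 ≤ l + l ^ 2 := by
  have := (abs_le.1 (Real.abs_exp_sub_one_sub_id_le h)).2
  linarith

/-! ### Balanced cuts -/

theorem exists_lowest_subset {V : Type*} [DecidableEq V] (M : Finset V) (f : V → ℕ) (k : ℕ)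
    (hk : k ≤ M.card) :
    ∃ L ⊆ M, L.card = k ∧ ∀ a ∈ L, ∀ b ∈ M \ L, f a ≤ f b := by
  induction k with
  | zero => exact ⟨∅, by simp, by simp, by simp⟩
  | succ k ih =>
    obtain ⟨L, hL, hc, hf⟩ := ih (by omega)
    have hne : (M \ L).Nonempty := by
      rw [← Finset.card_pos, Finset.card_sdiff_of_subset hL]; omega
    obtain ⟨m, hm, hmin⟩ := Finset.exists_min_image (M \ L) f hne
    rw [Finset.mem_sdiff] at hm
    refine ⟨insert m L, Finset.insert_subset hm.1 hL, by
      rw [Finset.card_insert_of_notMem hm.2, hc], fun a ha b hb => ?_⟩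
    simp only [Finset.mem_sdiff, Finset.mem_insert, not_or] at hb
    have hb' : b ∈ M \ L := Finset.mem_sdiff.2 ⟨hb.1, hb.2.2⟩
    rcases Finset.mem_insert.1 ha with rfl | ha
    · exact hmin b hb'
    · exact hf a ha b hb'

/-- A cut of the set `G` into a lower part (`bit = false`) and an upper part (`bit = true`), neither
of which has more than `29/30` of `G`. Here `w` is the number of pivots beaten (out of `s`), and `f`
and `f'` are the numbers of comparisons won and lost in the random graph. If `a` is put below `b`,
then either `w` says so; or they tie, at least half of the pivots are beaten, and `a` has one of the
lowest numbers of wins; or they tie, at most half of the pivots are beaten, and `b` has one of the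
lowest numbers of losses. -/
structure IsSplit {V : Type*} (G : Finset V) (w f f' : V → ℕ) (s : ℕ) (bit : V → Bool) :
    Prop where
  card_le : ∀ β, 30 * (G.filter fun a => bit a = β).card ≤ 29 * G.card
  order : ∀ a ∈ G, ∀ b ∈ G, bit a = false → bit b = true → w a < w b ∨
    (w a = w b ∧ s ≤ 2 * w a ∧ 9 * G.card ≤ 10 * (G.filter fun c => f a ≤ f c).card) ∨
    (w a = w b ∧ 2 * w a ≤ s ∧ 9 * G.card ≤ 10 * (G.filter fun c => f' b ≤ f' c).card)

/-- Cut between two levels of `w` if that is balanced. Otherwise a single level `w₀` of `w` has more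
than `9/10` of the elements, and the thirtieth of `G` with the fewest wins is cut off this level
from below, or the thirtieth with the fewest losses from above. -/
theorem exists_isSplit {V : Type*} [DecidableEq V] (G : Finset V) (hG : 2 ≤ G.card)
    (w f f' : V → ℕ) (s : ℕ) : ∃ bit, IsSplit G w f f' s bit := by
  set g := G.card with hg
  let N : ℕ → ℕ := fun t => (G.filter fun a => w a < t).card
  have hN : ∀ t, (G.filter fun a => w a < t).card = N t := fun t => rfl
  have hNc : ∀ t, (G.filter fun a => ¬ w a < t).card = g - N t := by
    intro t
    have := Finset.card_filter_add_card_filter_not (s := G) (fun a => w a < t)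
    rw [hN] at this
    omega
  by_cases hcut : ∃ t, g ≤ 30 * N t ∧ 30 * N t ≤ 29 * g
  · obtain ⟨t, h1, h2⟩ := hcut
    refine ⟨fun a => decide (¬ w a < t), ⟨fun β => ?_, fun a _ b _ ha hb => Or.inl ?_⟩⟩
    · cases β
      · simp only [decide_eq_false_iff_not, not_not]
        rw [hN]; exact h2
      · simp only [decide_eq_true_eq]
        rw [hNc]; omega
    · simp only [decide_eq_false_iff_not, not_not, decide_eq_true_eq] at ha hb
      omega
  push Not at hcut
  have hex : ∃ t, 29 * g < 30 * N t := by
    refine ⟨G.sup w + 1, ?_⟩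
    have : N (G.sup w + 1) = g := by
      simp only [N, hg]
      congr 1
      refine Finset.filter_true_of_mem fun a ha => ?_
      have := Finset.le_sup (f := w) ha
      omega
    omega
  classical
  have hfind := Nat.find_spec hex
  have hpos : Nat.find hex ≠ 0 := by
    intro h
    rw [h] at hfind
    simp [N] at hfind
  obtain ⟨w₀, hw₀⟩ := Nat.exists_eq_succ_of_ne_zero hpos
  rw [hw₀] at hfind
  have hlow : 30 * N w₀ < g := by
    have h1 : ¬ 29 * g < 30 * N w₀ := Nat.find_min hex (by omega)
    by_contra h2
    exact h1 (hcut w₀ (by omega))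
  set M := G.filter fun a => w a = w₀ with hM
  have hMcard : N w₀ + M.card = N (w₀ + 1) := by
    simp only [N, hM]
    rw [← Finset.card_union_of_disjoint]
    · congr 1
      ext a
      simp only [Finset.mem_union, Finset.mem_filter]
      constructor
      · rintro (h | h) <;> exact ⟨h.1, by omega⟩
      · rintro ⟨h1, h2⟩
        rcases Nat.lt_succ_iff_lt_or_eq.1 h2 with h | h
        · exact Or.inl ⟨h1, h⟩
        · exact Or.inr ⟨h1, h⟩
    · rw [Finset.disjoint_filter]
      intro a _ h; omega
  have hN1 : N (w₀ + 1) ≤ g := Finset.card_filter_le _ _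
  obtain ⟨k, hk1, hk2⟩ : ∃ k, g ≤ 30 * k ∧ 30 * k < g + 30 := ⟨(g + 29) / 30, by omega, by omega⟩
  have hMG : M ⊆ G := Finset.filter_subset _ _
  have hkM : k ≤ M.card := by rw [Nat.succ_eq_add_one] at hfind; omega
  -- All elements of the class outside the cut-off part have score at least that of `a`.
  have key : ∀ (h : V → ℕ) (L : Finset V), L ⊆ M → L.card = k →
      (∀ a ∈ L, ∀ b ∈ M \ L, h a ≤ h b) → ∀ a ∈ L,
      9 * g ≤ 10 * (G.filter fun c => h a ≤ h c).card := by
    intro h L hLM hLk hL a ha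
    have h1 : insert a (M \ L) ⊆ G.filter fun c => h a ≤ h c := by
      intro c hc
      rcases Finset.mem_insert.1 hc with rfl | hc
      · exact Finset.mem_filter.2 ⟨hMG (hLM ha), le_rfl⟩
      · exact Finset.mem_filter.2 ⟨hMG (Finset.mem_sdiff.1 hc).1, hL a ha c hc⟩
    have h2 := Finset.card_le_card h1
    rw [Finset.card_insert_of_notMem (by simp [ha]), Finset.card_sdiff_of_subset hLM, hLk] at h2
    rw [Nat.succ_eq_add_one] at hfind
    omega
  rw [Nat.succ_eq_add_one] at hfind
  rcases le_total s (2 * w₀) with hs | hs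
  · obtain ⟨L, hLM, hLk, hL⟩ := exists_lowest_subset M f k hkM
    have hcard : (G.filter fun a => w a < w₀ ∨ a ∈ L).card = N w₀ + k := by
      rw [Finset.filter_or, Finset.card_union_of_disjoint, Finset.filter_mem_eq_inter,
        Finset.inter_eq_right.2 (hLM.trans hMG), hLk]
      rw [Finset.filter_mem_eq_inter, Finset.inter_eq_right.2 (hLM.trans hMG),
        Finset.disjoint_left]
      intro a h1 h2
      have := (Finset.mem_filter.1 (hLM h2)).2
      have := (Finset.mem_filter.1 h1).2
      omega
    have hcard' := Finset.card_filter_add_card_filter_not (s := G) (fun a => w a < w₀ ∨ a ∈ L)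
    refine ⟨fun a => decide (¬ (w a < w₀ ∨ a ∈ L)), ⟨fun β => ?_, fun a ha' b hb' ha hb => ?_⟩⟩
    · cases β
      · simp only [decide_eq_false_iff_not, not_not]
        omega
      · simp only [decide_eq_true_eq]
        omega
    · simp only [decide_eq_false_iff_not, not_not] at ha
      simp only [decide_eq_true_eq, not_or] at hb
      rcases ha with ha | ha
      · left; omega
      · have hwa := (Finset.mem_filter.1 (hLM ha)).2
        rcases lt_or_eq_of_le (not_lt.1 hb.1) with h | h
        · left; omega
        · right; left
          exact ⟨by omega, by omega, key f L hLM hLk hL a ha⟩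
  · obtain ⟨L, hLM, hLk, hL⟩ := exists_lowest_subset M f' k hkM
    have hcard : (G.filter fun a => ¬ w a < w₀ + 1 ∨ a ∈ L).card = (g - N (w₀ + 1)) + k := by
      rw [Finset.filter_or, Finset.card_union_of_disjoint, Finset.filter_mem_eq_inter,
        Finset.inter_eq_right.2 (hLM.trans hMG), hLk, hNc]
      rw [Finset.filter_mem_eq_inter, Finset.inter_eq_right.2 (hLM.trans hMG),
        Finset.disjoint_left]
      intro a h1 h2
      have := (Finset.mem_filter.1 (hLM h2)).2
      have := (Finset.mem_filter.1 h1).2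
      omega
    have hcard' := Finset.card_filter_add_card_filter_not (s := G)
      (fun a => ¬ w a < w₀ + 1 ∨ a ∈ L)
    refine ⟨fun a => decide (¬ w a < w₀ + 1 ∨ a ∈ L), ⟨fun β => ?_, fun a ha' b hb' ha hb => ?_⟩⟩
    · cases β
      · simp only [decide_eq_false_iff_not]
        omega
      · simp only [decide_eq_true_eq]
        omega
    · simp only [decide_eq_false_iff_not, decide_eq_true_eq, not_or] at ha hb
      rcases hb with hb | hb
      · left; omega
      · have hwb := (Finset.mem_filter.1 (hLM hb)).2
        rcases lt_or_eq_of_le (Nat.lt_succ_iff.1 (not_not.1 ha.1)) with h | h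
        · left; omega
        · right; right
          exact ⟨by omega, by omega, key f' L hLM hLk hL b hb⟩

/-! ### Misplaced pairs need atypical draws -/

open Classical in
/-- The items of `G` that lose to `a` for certain. -/
noncomputable def lower {V : Type*} (G : Finset V) (x : V → ℝ) (a : V) : Finset V :=
  G.filter fun c => x c < x a - 1

open Classical in
/-- The items of `G` that lose to `a` and beat `b` for certain. -/
noncomputable def between {V : Type*} (G : Finset V) (x : V → ℝ) (a b : V) : Finset V :=
  G.filter fun c => x b + 1 < x c ∧ x c < x a - 1

/-- The ordered pairs that consist of `a` and an item of `S`. -/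
def incident {V : Type*} [DecidableEq V] (a : V) (S : Finset V) : Finset (V × V) :=
  {a} ×ˢ S ∪ S ×ˢ {a}

/-- The atypical draws for the pair `a`, `b`, where `p` are the pivots and `e` the edges of the
random graph. One of the following four counts is far from its mean. Too many pivots are `lower`
than `a`, although few items are; there is no pivot between `b` and `a`, although many items are;
too few edges join `a` to a lower item; too many edges join two items lower than `a`. The condition
depends on the draws alone and not on the answers of the adversary. -/
def Bad {V τ ι : Type*} [DecidableEq V] [Fintype τ] [Fintype ι] (G : Finset V) (x : V → ℝ)
    (K : ℕ) (p : τ → V) (e : ι → V × V) (a b : V) : Prop :=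
  (5 * (lower G x a).card < 2 * G.card ∧
    K ≤ 2 * (Finset.univ.filter fun t => p t ∈ lower G x a).card) ∨
  (G.card ≤ 20 * (between G x a b).card ∧
    (Finset.univ.filter fun t => p t ∈ between G x a b).card = 0) ∨
  (2 * G.card ≤ 5 * (lower G x a).card ∧
    10 * G.card * (Finset.univ.filter fun q => e q ∈ incident a (lower G x a)).card ≤
      18 * K * (lower G x a).card) ∨
  (2 * G.card ≤ 5 * (lower G x a).card ∧
    11 * K * (lower G x a).card ^ 2 ≤
      10 * G.card * (Finset.univ.filter fun q => e q ∈ lower G x a ×ˢ lower G x a).card)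

/-- If `a` exceeds `b` by more than `4`, ties with `b` against the pivots, beats at least half of
them, and has one of the lowest numbers of wins, then the draw is `Bad`.

As the pivots beaten by `b` are also beaten by `a`, both beat the same pivots. So no pivot lies
between `b` and `a`, hence few items do, and at least half of the pivots and many items are lower
than `a`. Let there be `m` items lower than `a`, out of `g`. As `a` beats all of them, it has about
`2 * m * K / g` wins. Almost all of the items up to `x b + 1` have at least as many wins, and as
they lose to everything from `x a - 1` on, they win only against the `m` items lower than `a`. But
there are only about `m ^ 2 * K / g` comparisons among these, half of what is needed. -/
theorem bad_of_misplaced {V τ ι : Type*} [Fintype τ] [Fintype ι] [DecidableEq V]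
    {G : Finset V} {x : V → ℝ} {K : ℕ} {p : τ → V} {e : ι → V × V} {win : ι → V}
    {W : V → τ → Prop} [∀ c, DecidablePred (W c)]
    (hp : ∀ t, p t ∈ G) (he : ∀ q, (e q).1 ∈ G ↔ (e q).2 ∈ G)
    (hW : ∀ c ∈ G, ∀ t, W c t → x (p t) ≤ x c + 1)
    (hW' : ∀ c ∈ G, ∀ t, ¬ W c t → x c ≤ x (p t) + 1)
    (hwin : ∀ q, (win q = (e q).1 ∧ x (e q).2 ≤ x (e q).1 + 1) ∨
      (win q = (e q).2 ∧ x (e q).1 ≤ x (e q).2 + 1))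
    {a b : V} (ha : a ∈ G) (hb : b ∈ G) (hab : x b + 4 < x a)
    (hcard : (Finset.univ.filter (W a)).card = (Finset.univ.filter (W b)).card)
    (hK : K ≤ 2 * (Finset.univ.filter (W a)).card)
    (hf : 9 * G.card ≤ 10 * (G.filter fun c => (Finset.univ.filter fun q => win q = a).card ≤
      (Finset.univ.filter fun q => win q = c).card).card) :
    Bad G x K p e a b := by
  classical
  have hsub : Finset.univ.filter (W b) ⊆ Finset.univ.filter (W a) := by
    intro t ht
    simp only [Finset.mem_filter, Finset.mem_univ, true_and] at ht ⊢
    by_contra h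
    have := hW b hb t ht
    have := hW' a ha t h
    linarith
  have heq := Finset.eq_of_subset_of_card_le hsub hcard.le
  have hiff : ∀ t, W b t ↔ W a t := by
    intro t
    have := Finset.ext_iff.1 heq t
    simpa using this
  by_contra hbad
  simp only [Bad, not_or, not_and] at hbad
  obtain ⟨h1, h2, h3, h4⟩ := hbad
  have hpl : (Finset.univ.filter (W a)).card ≤
      (Finset.univ.filter fun t => p t ∈ lower G x a).card := by
    refine Finset.card_le_card fun t ht => ?_
    simp only [Finset.mem_filter, Finset.mem_univ, true_and, lower] at ht ⊢
    have := hW b hb t ((hiff t).2 ht)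
    exact ⟨hp t, by linarith⟩
  have hpm : (Finset.univ.filter fun t => p t ∈ between G x a b).card = 0 := by
    rw [Finset.card_eq_zero, Finset.filter_eq_empty_iff]
    intro t _ ht
    simp only [between, Finset.mem_filter] at ht
    by_cases h : W b t
    · have := hW b hb t h; linarith
    · have := hW' a ha t fun h' => h ((hiff t).2 h'); linarith
  have hm : 2 * G.card ≤ 5 * (lower G x a).card := by
    by_contra h
    exact h1 (by omega) (by omega)
  have hmid : 20 * (between G x a b).card < G.card := by
    by_contra h
    exact h2 (by omega) hpm
  have h3 := h3 hm
  have h4 := h4 hm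
  set m := (lower G x a).card
  set X := (Finset.univ.filter fun q => e q ∈ incident a (lower G x a)).card with hX
  set E := (Finset.univ.filter fun q => e q ∈ lower G x a ×ˢ lower G x a).card with hE
  set L := G.filter fun c => x c ≤ x b + 1 with hL
  have hlm : m ≤ L.card + (between G x a b).card := by
    refine le_trans (Finset.card_le_card fun c hc => ?_) (Finset.card_union_le _ _)
    simp only [lower, between, hL, Finset.mem_union, Finset.mem_filter] at hc ⊢
    rcases le_or_gt (x c) (x b + 1) with h | h
    · exact Or.inl ⟨hc.1, h⟩
    · exact Or.inr ⟨hc.1, h, hc.2⟩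
  -- `a` wins against every lower item.
  have hXf : X ≤ (Finset.univ.filter fun q => win q = a).card := by
    refine Finset.card_le_card fun q hq => ?_
    simp only [incident, lower, Finset.mem_filter, Finset.mem_univ, true_and, Finset.mem_union,
      Finset.mem_product, Finset.mem_singleton] at hq ⊢
    rcases hq with ⟨h5, _, h6⟩ | ⟨⟨_, h6⟩, h5⟩
    · rcases hwin q with h | h
      · exact h.1.trans h5
      · rw [h5] at h; linarith
    · rcases hwin q with h | h
      · rw [h5] at h; linarith
      · exact h.1.trans h5
  -- An item of value at most `x b + 1` can win only against items lower than `a`.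
  have hfE : ∑ c ∈ L, (Finset.univ.filter fun q => win q = c).card ≤ E := by
    have h5 : ∑ c ∈ L, (Finset.univ.filter fun q => win q = c).card =
        (Finset.univ.filter fun q => win q ∈ L).card := by
      rw [Finset.card_eq_sum_card_fiberwise (f := win) (t := L)]
      · refine Finset.sum_congr rfl fun c hc => ?_
        congr 1
        ext q
        simp only [Finset.mem_filter, Finset.mem_univ, true_and]
        constructor
        · rintro rfl; exact ⟨hc, rfl⟩
        · exact fun h => h.2
      · intro q hq
        simpa using hq
    rw [h5]
    refine Finset.card_le_card fun q hq => ?_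
    simp only [hL, lower, Finset.mem_filter, Finset.mem_univ, true_and,
      Finset.mem_product] at hq ⊢
    rcases hwin q with h | h
    · rw [h.1] at hq
      exact ⟨⟨hq.1, by linarith⟩, (he q).1 hq.1, by linarith⟩
    · rw [h.1] at hq
      exact ⟨⟨(he q).2 hq.1, by linarith⟩, hq.1, by linarith⟩
  set cnt := (L.filter fun c => (Finset.univ.filter fun q => win q = a).card ≤
      (Finset.univ.filter fun q => win q = c).card).card with hcnt
  have hcX : cnt * X ≤ E := by
    rw [hcnt, ← smul_eq_mul]
    exact (Finset.card_nsmul_le_sum _ _ _ fun c hc => hXf.trans (Finset.mem_filter.1 hc).2).trans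
      ((Finset.sum_le_sum_of_subset (Finset.filter_subset _ L)).trans hfE)
  have hcL : 10 * L.card ≤ 10 * cnt + G.card := by
    have h5 := Finset.card_filter_add_card_filter_not (s := L)
      (fun c => (Finset.univ.filter fun q => win q = a).card ≤
      (Finset.univ.filter fun q => win q = c).card)
    have h6 := Finset.card_filter_add_card_filter_not (s := G)
      (fun c => (Finset.univ.filter fun q => win q = a).card ≤
      (Finset.univ.filter fun q => win q = c).card)
    have hLG : L ⊆ G := Finset.filter_subset _ _
    have h7 := Finset.card_le_card (Finset.filter_subset_filter
      (fun c => ¬ (Finset.univ.filter fun q => win q = a).card ≤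
      (Finset.univ.filter fun q => win q = c).card) hLG)
    omega
  -- The count of high-scoring low items is more than `5/8` of the items below `a`.
  have h58 : 5 * m ≤ 8 * cnt := by omega
  have h5 : cnt * (18 * K * m) ≤ cnt * (10 * G.card * X) := Nat.mul_le_mul_left _ (by omega)
  have h6 : 10 * G.card * (cnt * X) ≤ 10 * G.card * E := Nat.mul_le_mul_left _ hcX
  have h7 : (18 * K * m) * (5 * m) ≤ (18 * K * m) * (8 * cnt) := Nat.mul_le_mul_left _ h58
  nlinarith

/-! ### Blocks and random draws -/

/-- The current block of `i` as a type. The algorithm keeps an ordered partition of the items into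
blocks, encoded as a function `key`: the blocks are its fibres, in increasing order. -/
abbrev Block {n : ℕ} (key : Fin n → ℕ) (i : Fin n) : Type := {j : Fin n // key j = key i}

/-- The current block of `i` as a finset. -/
def block {n : ℕ} (key : Fin n → ℕ) (i : Fin n) : Finset (Fin n) :=
  Finset.univ.filter fun j => key j = key i

/-- The random draw of one level: for each item and each `t < K`, three independent uniform items
of its block, namely a candidate for a pivot and the two ends of an edge of the random graph. -/
abbrev Draw {n : ℕ} (key : Fin n → ℕ) (K : ℕ) : Type :=
  (q : Fin n × Fin K) → Block key q.1 × Block key q.1 × Block key q.1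

instance {n : ℕ} (key : Fin n → ℕ) (i : Fin n) : Nonempty (Block key i) := ⟨⟨i, rfl⟩⟩

theorem exists_key_eq {n : ℕ} (key : Fin n → ℕ) (i : Fin n) : ∃ j, key j = key i := ⟨i, rfl⟩

/-- An item of the block of `i` that depends on the block only. -/
noncomputable def rep {n : ℕ} (key : Fin n → ℕ) (i : Fin n) : Fin n :=
  (exists_key_eq key i).choose

theorem key_rep {n : ℕ} (key : Fin n → ℕ) (i : Fin n) : key (rep key i) = key i :=
  (exists_key_eq key i).choose_spec

theorem rep_eq {n : ℕ} {key : Fin n → ℕ} {i j : Fin n} (h : key i = key j) :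
    rep key i = rep key j := by
  unfold rep
  congr 1
  funext k
  rw [h]

theorem block_eq {n : ℕ} {key : Fin n → ℕ} {i j : Fin n} (h : key i = key j) :
    block key i = block key j := by
  unfold block
  rw [h]

theorem mem_block {n : ℕ} {key : Fin n → ℕ} {i j : Fin n} :
    j ∈ block key i ↔ key j = key i := by simp [block]

theorem card_block_pos {n : ℕ} (key : Fin n → ℕ) (i : Fin n) : 0 < (block key i).card :=
  Finset.card_pos.2 ⟨i, mem_block.2 rfl⟩

theorem card_Block {n : ℕ} (key : Fin n → ℕ) (i : Fin n) :
    Fintype.card (Block key i) = (block key i).card := by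
  rw [Fintype.card_subtype]; rfl

/-- The `t`-th pivot of the block of `i`. It is taken from the draws of the representative, so that
all items of a block have the same pivots. -/
noncomputable def pivot {n : ℕ} {key : Fin n → ℕ} {K : ℕ} (ω : Draw key K) (i : Fin n)
    (t : Fin K) : Fin n :=
  (ω (rep key i, t)).1

/-- The edge of the random graph with index `q`: a uniform pair of items of the block of `q.1`.
As both ends are random, the adversary cannot treat them differently. -/
def edge {n : ℕ} {key : Fin n → ℕ} {K : ℕ} (ω : Draw key K) (q : Fin n × Fin K) :
    Fin n × Fin n :=
  ((ω q).2.1, (ω q).2.2)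

theorem card_filter_fst_mem {n : ℕ} (key : Fin n → ℕ) (i : Fin n) {S : Finset (Fin n)}
    (hS : S ⊆ block key i) :
    ((Finset.univ.filter fun k : Block key i × Block key i × Block key i => k.1.1 ∈ S).card : ℝ) /
      Fintype.card (Block key i × Block key i × Block key i) = S.card / (block key i).card := by
  have h : (Finset.univ.filter fun k : Block key i × Block key i × Block key i => k.1.1 ∈ S) =
      (Finset.univ.filter fun u : Block key i => u.1 ∈ S) ×ˢ Finset.univ := by
    ext k; simp
  have h2 : (Finset.univ.filter fun u : Block key i => u.1 ∈ S).card = S.card := by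
    rw [← Finset.card_map (Function.Embedding.subtype _)]
    congr 1
    ext j
    simp only [Finset.mem_map, Finset.mem_filter, Finset.mem_univ, true_and]
    constructor
    · rintro ⟨u, hu, rfl⟩; exact hu
    · exact fun hj => ⟨⟨j, mem_block.1 (hS hj)⟩, hj, rfl⟩
  have hg : ((block key i).card : ℝ) ≠ 0 := by exact_mod_cast (card_block_pos key i).ne'
  rw [h, Finset.card_product, h2, Finset.card_univ]
  simp only [Fintype.card_prod, card_Block, Nat.cast_mul]
  field_simp

theorem card_filter_snd_mem {n : ℕ} (key : Fin n → ℕ) (i : Fin n) {T : Finset (Fin n × Fin n)}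
    (hT : T ⊆ block key i ×ˢ block key i) :
    ((Finset.univ.filter fun k : Block key i × Block key i × Block key i =>
      (k.2.1.1, k.2.2.1) ∈ T).card : ℝ) /
      Fintype.card (Block key i × Block key i × Block key i) =
      T.card / ((block key i).card : ℝ) ^ 2 := by
  have h : (Finset.univ.filter fun k : Block key i × Block key i × Block key i =>
      (k.2.1.1, k.2.2.1) ∈ T) = Finset.univ ×ˢ
      (Finset.univ.filter fun u : Block key i × Block key i => (u.1.1, u.2.1) ∈ T) := by
    ext k; simp
  have h2 : (Finset.univ.filter fun u : Block key i × Block key i =>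
      (u.1.1, u.2.1) ∈ T).card = T.card := by
    refine Finset.card_bij (fun u _ => (u.1.1, u.2.1)) (fun u hu => by simpa using hu)
      (fun u _ v _ huv => ?_) (fun j hj => ?_)
    · simp only [Prod.mk.injEq] at huv
      exact Prod.ext (Subtype.ext huv.1) (Subtype.ext huv.2)
    · have := Finset.mem_product.1 (hT hj)
      exact ⟨(⟨j.1, mem_block.1 this.1⟩, ⟨j.2, mem_block.1 this.2⟩), by simpa using hj, rfl⟩
  have hg : ((block key i).card : ℝ) ≠ 0 := by exact_mod_cast (card_block_pos key i).ne'
  rw [h, Finset.card_product, h2, Finset.card_univ]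
  simp only [Fintype.card_prod, card_Block, Nat.cast_mul]
  field_simp

/-- Chernoff's bound for the number of pivots of the block of `i` in a set `S`. -/
theorem card_le_of_pivots {n : ℕ} {key : Fin n → ℕ} {K : ℕ} (i : Fin n) {S : Finset (Fin n)}
    (hS : S ⊆ block key i) (l u : ℝ) (T : Finset (Draw key K))
    (hT : ∀ ω ∈ T, l * u ≤ l * (Finset.univ.filter fun t => pivot ω i t ∈ S).card) :
    (T.card : ℝ) ≤ Real.exp (-(l * u) + (Real.exp l - 1) *
      (K * (S.card / (block key i).card))) * Fintype.card (Draw key K) := by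
  classical
  have hS' : S ⊆ block key (rep key i) := by rwa [block_eq (key_rep key i)]
  have h := card_le_exp_mul_card
    (κ := fun q : Fin n × Fin K => Block key q.1 × Block key q.1 × Block key q.1)
    (fun q k => q.1 = rep key i ∧ k.1.1 ∈ S) l u T (fun ω hω => by
      refine (hT ω hω).trans (le_of_eq ?_)
      congr 2
      refine Finset.card_bij (fun t _ => (rep key i, t)) (fun t ht => ?_) (fun t _ t' _ h => ?_)
        (fun q hq => ?_)
      · exact Finset.mem_filter.2 ⟨Finset.mem_univ _, rfl, (Finset.mem_filter.1 ht).2⟩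
      · simpa using h
      · obtain ⟨j, t⟩ := q
        simp only [Finset.mem_filter, Finset.mem_univ, true_and] at hq
        obtain ⟨rfl, h2⟩ := hq
        exact ⟨t, Finset.mem_filter.2 ⟨Finset.mem_univ _, h2⟩, rfl⟩)
  refine h.trans (le_of_eq ?_)
  congr 4
  rw [Fintype.sum_prod_type, Finset.sum_eq_single (rep key i)]
  · simp only [true_and, card_filter_fst_mem key _ hS', block_eq (key_rep key i)]
    simp
  · intro j _ hj
    simp [hj]
  · simp

/-- Chernoff's bound for the number of edges in a set `S` of pairs from the block of `i`; each of the
`g * K` edges of a block of `g` items is in `S` with probability `S.card / g ^ 2`. -/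
theorem card_le_of_edges {n : ℕ} {key : Fin n → ℕ} {K : ℕ} (i : Fin n)
    {S : Finset (Fin n × Fin n)} (hS : S ⊆ block key i ×ˢ block key i) (l u : ℝ)
    (T : Finset (Draw key K))
    (hT : ∀ ω ∈ T, l * u ≤ l * (Finset.univ.filter fun q => edge ω q ∈ S).card) :
    (T.card : ℝ) ≤ Real.exp (-(l * u) + (Real.exp l - 1) *
      (K * (S.card / (block key i).card))) * Fintype.card (Draw key K) := by
  classical
  have h := card_le_exp_mul_card
    (κ := fun q : Fin n × Fin K => Block key q.1 × Block key q.1 × Block key q.1)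
    (fun q k => (k.2.1.1, k.2.2.1) ∈ S) l u T hT
  refine h.trans (le_of_eq ?_)
  congr 4
  have hg : ((block key i).card : ℝ) ≠ 0 := by exact_mod_cast (card_block_pos key i).ne'
  have h1 : ∀ q : Fin n × Fin K,
      ((Finset.univ.filter fun k : Block key q.1 × Block key q.1 × Block key q.1 =>
        (k.2.1.1, k.2.2.1) ∈ S).card : ℝ) /
        Fintype.card (Block key q.1 × Block key q.1 × Block key q.1) =
      if q.1 ∈ block key i then S.card / ((block key i).card : ℝ) ^ 2 else 0 := by
    intro q
    split_ifs with hq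
    · have hb := block_eq (mem_block.1 hq)
      rw [← hb] at hS ⊢
      exact card_filter_snd_mem key q.1 hS
    · rw [Finset.filter_false_of_mem]
      · simp
      · rintro k _ hk
        have h2 := mem_block.1 (Finset.mem_product.1 (hS hk)).1
        exact hq (mem_block.2 (k.2.1.2.symm.trans h2))
  rw [Finset.sum_congr rfl fun q _ => h1 q, Fintype.sum_prod_type]
  have h2 : ∀ j : Fin n, (∑ _t : Fin K, if j ∈ block key i then
      (S.card : ℝ) / ((block key i).card : ℝ) ^ 2 else 0) =
      if j ∈ block key i then K * (S.card / ((block key i).card : ℝ) ^ 2) else 0 := by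
    intro j
    split_ifs <;> simp
  rw [Finset.sum_congr rfl fun j _ => h2 j, Finset.sum_ite_mem, Finset.univ_inter,
    Finset.sum_const, nsmul_eq_mul]
  field_simp

theorem card_filter_le_four_mul {α : Type*} [Fintype α] [DecidableEq α] {P Q₁ Q₂ Q₃ Q₄ : α → Prop}
    [DecidablePred P] [DecidablePred Q₁] [DecidablePred Q₂] [DecidablePred Q₃]
    [DecidablePred Q₄] {c : ℝ} (h : ∀ ω, P ω → Q₁ ω ∨ Q₂ ω ∨ Q₃ ω ∨ Q₄ ω)
    (h₁ : ((Finset.univ.filter Q₁).card : ℝ) ≤ c) (h₂ : ((Finset.univ.filter Q₂).card : ℝ) ≤ c)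
    (h₃ : ((Finset.univ.filter Q₃).card : ℝ) ≤ c) (h₄ : ((Finset.univ.filter Q₄).card : ℝ) ≤ c) :
    ((Finset.univ.filter P).card : ℝ) ≤ 4 * c := by
  have hsub : Finset.univ.filter P ⊆ Finset.univ.filter Q₁ ∪ (Finset.univ.filter Q₂ ∪
      (Finset.univ.filter Q₃ ∪ Finset.univ.filter Q₄)) := by
    intro ω hω
    simpa using h ω (Finset.mem_filter.1 hω).2
  have h5 := (Finset.card_le_card hsub).trans ((Finset.card_union_le _ _).trans
    (Nat.add_le_add_left ((Finset.card_union_le _ _).trans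
      (Nat.add_le_add_left (Finset.card_union_le _ _) _)) _))
  have h6 := (Nat.cast_le (α := ℝ)).2 h5
  push_cast at h6
  linarith

open Classical in
/-- Each of the four alternatives in `Bad` has probability at most `exp (-K / 2500)`. For the edges,
a deviation by a tenth from the mean `μ` has probability at most `exp (-μ / 400)`, by `l = ±1/20`,
and `μ` is at least `4/25 * K` as at least `2/5` of the block is lower than `a`. -/
theorem card_bad_le {n : ℕ} (key : Fin n → ℕ) (K : ℕ) (x : Fin n → ℝ) (a b : Fin n) :
    ((Finset.univ.filter fun ω : Draw key K =>
      Bad (block key a) x K (pivot ω a) (edge ω) a b).card : ℝ) ≤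
      4 * Real.exp (-(K / 2500)) * Fintype.card (Draw key K) := by
  set G := block key a with hG
  set S := lower G x a with hSdef
  set M := between G x a b with hMdef
  have hSG : S ⊆ G := Finset.filter_subset _ _
  have hMG : M ⊆ G := Finset.filter_subset _ _
  have haS : a ∉ S := by
    simp only [hSdef, lower, Finset.mem_filter, not_and]
    intro _; linarith
  have hgpos : (0 : ℝ) < G.card := by exact_mod_cast card_block_pos key a
  have hg1 : (1 : ℝ) ≤ G.card := by exact_mod_cast card_block_pos key a
  have hD : (0 : ℝ) ≤ Fintype.card (Draw key K) := Nat.cast_nonneg _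
  have hK : (0 : ℝ) ≤ K := Nat.cast_nonneg _
  have h1 : ((Finset.univ.filter fun ω : Draw key K => 5 * S.card < 2 * G.card ∧
      K ≤ 2 * (Finset.univ.filter fun t => pivot ω a t ∈ S).card).card : ℝ) ≤
      Real.exp (-(K / 2500)) * Fintype.card (Draw key K) := by
    by_cases hc : 5 * S.card < 2 * G.card
    · refine (card_le_of_pivots a hSG (1 / 8) (K / 2) _ fun ω hω => ?_).trans
        (mul_le_mul_of_nonneg_right (Real.exp_le_exp.2 ?_) hD)
      · have h : (K : ℝ) ≤ 2 * (Finset.univ.filter fun t => pivot ω a t ∈ S).card := by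
          exact_mod_cast (Finset.mem_filter.1 hω).2.2
        linarith
      · have he := exp_sub_one_le (l := 1 / 8) (by rw [abs_of_pos] <;> norm_num)
        have hr : (S.card : ℝ) / G.card ≤ 2 / 5 := by
          rw [div_le_div_iff₀ hgpos (by norm_num)]
          have : (5 : ℝ) * S.card < 2 * G.card := by exact_mod_cast hc
          linarith
        have hr0 : (0 : ℝ) ≤ (S.card : ℝ) / G.card := by positivity
        have h2 : (K : ℝ) * (S.card / G.card) ≤ K * (2 / 5) := mul_le_mul_of_nonneg_left hr hK
        have h3 := mul_le_mul_of_nonneg_right he (mul_nonneg hK hr0)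
        nlinarith
    · rw [Finset.filter_false_of_mem (by intro ω _ h; exact hc h.1)]
      simp only [Finset.card_empty, Nat.cast_zero]
      positivity
  have h2 : ((Finset.univ.filter fun ω : Draw key K => G.card ≤ 20 * M.card ∧
      (Finset.univ.filter fun t => pivot ω a t ∈ M).card = 0).card : ℝ) ≤
      Real.exp (-(K / 2500)) * Fintype.card (Draw key K) := by
    by_cases hc : G.card ≤ 20 * M.card
    · refine (card_le_of_pivots a hMG (-1 / 2) 0 _ fun ω hω => ?_).trans
        (mul_le_mul_of_nonneg_right (Real.exp_le_exp.2 ?_) hD)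
      · rw [(Finset.mem_filter.1 hω).2.2]; simp
      · have he := exp_sub_one_le (l := -1 / 2) (by rw [abs_of_neg] <;> norm_num)
        have hr : 1 / 20 ≤ (M.card : ℝ) / G.card := by
          rw [div_le_div_iff₀ (by norm_num) hgpos]
          have : (G.card : ℝ) ≤ 20 * M.card := by exact_mod_cast hc
          linarith
        have h2 : (K : ℝ) * (1 / 20) ≤ K * (M.card / G.card) := mul_le_mul_of_nonneg_left hr hK
        have h3 := mul_le_mul_of_nonneg_right he (h2.trans' (by positivity))
        nlinarith
    · rw [Finset.filter_false_of_mem (by intro ω _ h; exact hc h.1)]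
      simp only [Finset.card_empty, Nat.cast_zero]
      positivity
  have h3 : ((Finset.univ.filter fun ω : Draw key K => 2 * G.card ≤ 5 * S.card ∧
      10 * G.card * (Finset.univ.filter fun q => edge ω q ∈ incident a S).card ≤
        18 * K * S.card).card : ℝ) ≤
      Real.exp (-(K / 2500)) * Fintype.card (Draw key K) := by
    by_cases hc : 2 * G.card ≤ 5 * S.card
    · have haG : a ∈ G := mem_block.2 rfl
      have hsub : incident a S ⊆ G ×ˢ G := by
        refine Finset.union_subset ?_ ?_
        · exact Finset.product_subset_product (Finset.singleton_subset_iff.2 haG) hSG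
        · exact Finset.product_subset_product hSG (Finset.singleton_subset_iff.2 haG)
      have hcard : (incident a S).card = 2 * S.card := by
        unfold incident
        rw [Finset.card_union_of_disjoint, Finset.card_product, Finset.card_product,
          Finset.card_singleton]
        · ring
        · rw [Finset.disjoint_left]
          rintro ⟨u, v⟩ h4 h5
          simp only [Finset.mem_product, Finset.mem_singleton] at h4 h5
          exact haS (h4.1 ▸ h5.1)
      refine (card_le_of_edges a hsub (-1 / 20) (9 / 10 * (K * ((2 * S.card) / G.card))) _
        fun ω hω => ?_).trans (mul_le_mul_of_nonneg_right (Real.exp_le_exp.2 ?_) hD)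
      · have h : (10 : ℝ) * G.card *
            (Finset.univ.filter fun q => edge ω q ∈ incident a S).card ≤ 18 * K * S.card := by
          exact_mod_cast (Finset.mem_filter.1 hω).2.2
        have h' : ((Finset.univ.filter fun q => edge ω q ∈ incident a S).card : ℝ) ≤
            9 / 10 * (K * ((2 * S.card) / G.card)) := by
          rw [← mul_div_assoc, ← mul_div_assoc, le_div_iff₀ hgpos]
          linarith
        linarith
      · have he := exp_sub_one_le (l := -1 / 20) (by rw [abs_of_neg] <;> norm_num)
        rw [hcard]
        push_cast
        have hr : 4 / 5 ≤ (2 * (S.card : ℝ)) / G.card := by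
          rw [div_le_div_iff₀ (by norm_num) hgpos]
          have : (2 : ℝ) * G.card ≤ 5 * S.card := by exact_mod_cast hc
          linarith
        have h2 : (K : ℝ) * (4 / 5) ≤ K * (2 * S.card / G.card) := mul_le_mul_of_nonneg_left hr hK
        have h3 := mul_le_mul_of_nonneg_right he (h2.trans' (by positivity))
        nlinarith
    · rw [Finset.filter_false_of_mem (by intro ω _ h; exact hc h.1)]
      simp only [Finset.card_empty, Nat.cast_zero]
      positivity
  have h4 : ((Finset.univ.filter fun ω : Draw key K => 2 * G.card ≤ 5 * S.card ∧
      11 * K * S.card ^ 2 ≤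
        10 * G.card * (Finset.univ.filter fun q => edge ω q ∈ S ×ˢ S).card).card : ℝ) ≤
      Real.exp (-(K / 2500)) * Fintype.card (Draw key K) := by
    by_cases hc : 2 * G.card ≤ 5 * S.card
    · refine (card_le_of_edges a (Finset.product_subset_product hSG hSG) (1 / 20)
        (11 / 10 * (K * (S.card ^ 2 / G.card))) _
        fun ω hω => ?_).trans (mul_le_mul_of_nonneg_right (Real.exp_le_exp.2 ?_) hD)
      · have h : (11 : ℝ) * K * S.card ^ 2 ≤ 10 * G.card *
            (Finset.univ.filter fun q => edge ω q ∈ S ×ˢ S).card := by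
          exact_mod_cast (Finset.mem_filter.1 hω).2.2
        have h' : 11 / 10 * (K * (S.card ^ 2 / G.card)) ≤
            ((Finset.univ.filter fun q => edge ω q ∈ S ×ˢ S).card : ℝ) := by
          rw [← mul_div_assoc, ← mul_div_assoc, div_le_iff₀ hgpos]
          linarith
        linarith
      · have he := exp_sub_one_le (l := 1 / 20) (by rw [abs_of_pos] <;> norm_num)
        rw [Finset.card_product]
        push_cast
        rw [← sq]
        have hr : 4 / 25 ≤ (S.card : ℝ) ^ 2 / G.card := by
          rw [le_div_iff₀ hgpos]
          have : (2 : ℝ) * G.card ≤ 5 * S.card := by exact_mod_cast hc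
          nlinarith
        have h2 : (K : ℝ) * (4 / 25) ≤ K * (S.card ^ 2 / G.card) :=
          mul_le_mul_of_nonneg_left hr hK
        have h3 := mul_le_mul_of_nonneg_right he (h2.trans' (by positivity))
        nlinarith
    · rw [Finset.filter_false_of_mem (by intro ω _ h; exact hc h.1)]
      simp only [Finset.card_empty, Nat.cast_zero]
      positivity
  rw [mul_assoc]
  exact card_filter_le_four_mul (fun ω h => h) h1 h2 h3 h4

/-! ### Sampling and asking -/

/-- Draw a uniformly random element of `Ω` and continue with it. -/
noncomputable def sample {n : ℕ} (Ω : Type) [Fintype Ω] [Nonempty Ω] (next : Ω → SortAlg n) :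
    SortAlg n :=
  .random (Fintype.card Ω - 1) fun r => next ((Fintype.equivFin Ω).symm
    (Fin.cast (Nat.sub_add_cancel Fintype.card_pos) r))

/-- Submit the comparisons `query i` in one round and continue with the answers. -/
noncomputable def ask {n : ℕ} {ι : Type} [Fintype ι] (query : ι → Fin n × Fin n)
    (next : (ι → Bool) → SortAlg n) : SortAlg n :=
  .round (Fintype.card ι) (fun t => query ((Fintype.equivFin ι).symm t))
    fun ans => next fun i => ans (Fintype.equivFin ι i)

theorem maxComparisons_sample_le {n c : ℕ} {Ω : Type} [Fintype Ω] [Nonempty Ω]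
    {next : Ω → SortAlg n} (h : ∀ ω, (next ω).maxComparisons ≤ c) :
    (sample Ω next).maxComparisons ≤ c :=
  Finset.sup_le fun _ _ => h _

theorem maxRounds_sample_le {n c : ℕ} {Ω : Type} [Fintype Ω] [Nonempty Ω]
    {next : Ω → SortAlg n} (h : ∀ ω, (next ω).maxRounds ≤ c) :
    (sample Ω next).maxRounds ≤ c :=
  Finset.sup_le fun _ _ => h _

theorem maxComparisons_ask_le {n c : ℕ} {ι : Type} [Fintype ι] {query : ι → Fin n × Fin n}
    {next : (ι → Bool) → SortAlg n} (h : ∀ ans, (next ans).maxComparisons ≤ c) :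
    (ask query next).maxComparisons ≤ Fintype.card ι + c :=
  Nat.add_le_add_left (Finset.sup_le fun _ _ => h _) _

theorem maxRounds_ask_le {n c : ℕ} {ι : Type} [Fintype ι] {query : ι → Fin n × Fin n}
    {next : (ι → Bool) → SortAlg n} (h : ∀ ans, (next ans).maxRounds ≤ c) :
    (ask query next).maxRounds ≤ 1 + c :=
  Nat.add_le_add_left (Finset.sup_le fun _ _ => h _) _

/-- The failure probability after a uniform draw is at most the probability `δ` of the exceptional
draws plus the failure probability `ε` after each other draw. -/
theorem run_sample_le {n : ℕ} (A : Strategy n) (h : List (RoundRecord n))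
    {Ω : Type} [Fintype Ω] [Nonempty Ω] {next : Ω → SortAlg n} {B : Set (Equiv.Perm (Fin n))}
    (S : Finset Ω) {δ ε : ℝ} (hδ : 0 ≤ δ) (hε : 0 ≤ ε) (hS : (S.card : ℝ) ≤ δ * Fintype.card Ω)
    (hnext : ∀ ω ∉ S, ((next ω).run A h).toOuterMeasure B ≤ ENNReal.ofReal ε) :
    ((sample Ω next).run A h).toOuterMeasure B ≤ ENNReal.ofReal (δ + ε) := by
  classical
  have hN : Fintype.card Ω - 1 + 1 = Fintype.card Ω := Nat.sub_add_cancel Fintype.card_pos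
  have hN0 : (Fintype.card Ω : ENNReal) ≠ 0 := by exact_mod_cast Fintype.card_ne_zero
  have hNt : (Fintype.card Ω : ENNReal) ≠ ⊤ := ENNReal.natCast_ne_top _
  let e : Fin (Fintype.card Ω - 1 + 1) ≃ Ω := (finCongr hN).trans (Fintype.equivFin Ω).symm
  have hrun : ((sample Ω next).run A h).toOuterMeasure B =
      ∑ ω, (Fintype.card Ω : ENNReal)⁻¹ * ((next ω).run A h).toOuterMeasure B := by
    change ((PMF.uniformOfFintype (Fin (Fintype.card Ω - 1 + 1))).bind fun r =>
      SortAlg.run A (next (e r)) h).toOuterMeasure B = _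
    have hc : ((Fintype.card Ω - 1 + 1 : ℕ) : ENNReal) = Fintype.card Ω := by rw [hN]
    rw [PMF.toOuterMeasure_bind_apply, tsum_fintype, ← Equiv.sum_comp e]
    refine Finset.sum_congr rfl fun r _ => ?_
    rw [PMF.uniformOfFintype_apply, Fintype.card_fin, hc]
  have hle : ∀ ω, ((next ω).run A h).toOuterMeasure B ≤
      (if ω ∈ S then 1 else 0) + ENNReal.ofReal ε := by
    intro ω
    split_ifs with hω
    · refine le_trans ?_ le_self_add
      rw [PMF.toOuterMeasure_apply, ← ((next ω).run A h).tsum_coe]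
      exact ENNReal.tsum_le_tsum fun σ => Set.indicator_le_self _ _ _
    · rw [zero_add]; exact hnext ω hω
  rw [hrun, ← Finset.mul_sum]
  have hsum : ∑ ω, ((next ω).run A h).toOuterMeasure B ≤
      S.card + Fintype.card Ω * ENNReal.ofReal ε := by
    refine (Finset.sum_le_sum fun ω _ => hle ω).trans (le_of_eq ?_)
    rw [Finset.sum_add_distrib, Finset.sum_ite_mem, Finset.univ_inter]
    simp
  have hS' : (S.card : ENNReal) ≤ Fintype.card Ω * ENNReal.ofReal δ := by
    rw [← ENNReal.ofReal_natCast, ← ENNReal.ofReal_natCast, ← ENNReal.ofReal_mul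
      (Nat.cast_nonneg _)]
    exact ENNReal.ofReal_le_ofReal (by linarith)
  calc (Fintype.card Ω : ENNReal)⁻¹ * ∑ ω, ((next ω).run A h).toOuterMeasure B
      ≤ (Fintype.card Ω : ENNReal)⁻¹ *
        (Fintype.card Ω * (ENNReal.ofReal δ + ENNReal.ofReal ε)) := by
        refine mul_le_mul_right ?_ _
        rw [mul_add]
        exact hsum.trans (add_le_add_left hS' _)
    _ = ENNReal.ofReal (δ + ε) := by
        rw [← mul_assoc, ENNReal.inv_mul_cancel hN0 hNt, one_mul, ENNReal.ofReal_add hδ hε]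

/-- The answers respect all comparisons of values that differ by more than `1`. -/
def ValidAnswers {n : ℕ} {ι : Type} (x : Fin n → ℝ) (query : ι → Fin n × Fin n)
    (ans : ι → Bool) : Prop :=
  ∀ q, (1 < x (query q).1 - x (query q).2 → ans q = true) ∧
    (1 < x (query q).2 - x (query q).1 → ans q = false)

theorem run_ask_le {n : ℕ} {x : Fin n → ℝ} {A : Strategy n} (hA : A.IsAdversarialComparator x)
    (h : List (RoundRecord n)) {ι : Type} [Fintype ι] {query : ι → Fin n × Fin n}
    {next : (ι → Bool) → SortAlg n} {B : Set (Equiv.Perm (Fin n))} {ε : ENNReal}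
    (hnext : ∀ ans, ValidAnswers x query ans → ∀ h, ((next ans).run A h).toOuterMeasure B ≤ ε) :
    ((ask query next).run A h).toOuterMeasure B ≤ ε := by
  unfold ask SortAlg.run
  refine hnext _ (fun q => ?_) _
  have := hA h (Fintype.card ι) (fun t => query ((Fintype.equivFin ι).symm t))
    (Fintype.equivFin ι q)
  simpa only [Equiv.symm_apply_apply] using this

/-! ### One level of the algorithm -/

/-- The comparisons of one level: each item with all pivots of its block (third index `true`), and
the edges of the random graph (third index `false`). -/
noncomputable def query {n : ℕ} {key : Fin n → ℕ} {K : ℕ} (ω : Draw key K) :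
    Fin n × Fin K × Bool → Fin n × Fin n
  | (i, t, true) => (i, pivot ω i t)
  | (i, t, false) => edge ω (i, t)

/-- The number of pivots that `i` beats. -/
def score {n K : ℕ} (ans : Fin n × Fin K × Bool → Bool) (i : Fin n) : ℕ :=
  (Finset.univ.filter fun t => ans (i, t, true) = true).card

/-- The end of the edge `q` that is reported as the larger item. -/
def winner {n : ℕ} {key : Fin n → ℕ} {K : ℕ} (ω : Draw key K)
    (ans : Fin n × Fin K × Bool → Bool) (q : Fin n × Fin K) : Fin n :=
  if ans (q.1, q.2, false) then (edge ω q).1 else (edge ω q).2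

/-- The end of the edge `q` that is reported as the smaller item. -/
def loser {n : ℕ} {key : Fin n → ℕ} {K : ℕ} (ω : Draw key K)
    (ans : Fin n × Fin K × Bool → Bool) (q : Fin n × Fin K) : Fin n :=
  if ans (q.1, q.2, false) then (edge ω q).2 else (edge ω q).1

/-- A chosen cut of `G`; a set with at most one element is not cut. -/
noncomputable def splitBit {V : Type*} [DecidableEq V] (G : Finset V) (w f f' : V → ℕ) (s : ℕ) :
    V → Bool :=
  if h : 2 ≤ G.card then (exists_isSplit G h w f f' s).choose else fun _ => false

theorem isSplit_splitBit {V : Type*} [DecidableEq V] {G : Finset V} (h : 2 ≤ G.card)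
    (w f f' : V → ℕ) (s : ℕ) : IsSplit G w f f' s (splitBit G w f f' s) := by
  unfold splitBit
  rw [dif_pos h]
  exact (exists_isSplit G h w f f' s).choose_spec

/-- The side of the cut of the block `G` that an item is put on after the answers `ans`. -/
noncomputable def side {n : ℕ} {key : Fin n → ℕ} {K : ℕ} (ω : Draw key K)
    (ans : Fin n × Fin K × Bool → Bool) (G : Finset (Fin n)) : Fin n → Bool :=
  splitBit G (score ans) (fun c => (Finset.univ.filter fun q => winner ω ans q = c).card)
    (fun c => (Finset.univ.filter fun q => loser ω ans q = c).card) K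

/-- The ordered partition in which every block is replaced by the two sides of its cut. -/
noncomputable def refinedKey {n : ℕ} {key : Fin n → ℕ} {K : ℕ} (ω : Draw key K)
    (ans : Fin n × Fin K × Bool → Bool) (i : Fin n) : ℕ :=
  2 * key i + (side ω ans (block key i) i).toNat

theorem card_block_refinedKey {n : ℕ} {key : Fin n → ℕ} {K : ℕ} (ω : Draw key K)
    (ans : Fin n × Fin K × Bool → Bool) (i : Fin n) :
    (block (refinedKey ω ans) i).card ≤ 1 ∨
      30 * (block (refinedKey ω ans) i).card ≤ 29 * (block key i).card := by
  have hsub : block (refinedKey ω ans) i ⊆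
      (block key i).filter fun j => side ω ans (block key i) j = side ω ans (block key i) i := by
    intro j hj
    have h1 : 2 * key j + (side ω ans (block key j) j).toNat =
        2 * key i + (side ω ans (block key i) i).toNat := mem_block.1 hj
    have h2 := Bool.toNat_le (side ω ans (block key j) j)
    have h3 := Bool.toNat_le (side ω ans (block key i) i)
    have hk : key j = key i := by omega
    rw [block_eq hk] at h1
    refine Finset.mem_filter.2 ⟨mem_block.2 hk, ?_⟩
    revert h1
    cases side ω ans (block key i) j <;> cases side ω ans (block key i) i <;> simp <;> omega
  have hle := Finset.card_le_card hsub
  rcases Nat.lt_or_ge (block key i).card 2 with h | h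
  · have := Finset.card_filter_le (block key i)
      (fun j => side ω ans (block key i) j = side ω ans (block key i) i)
    left; omega
  · have := (isSplit_splitBit h (score ans)
      (fun c => (Finset.univ.filter fun q => winner ω ans q = c).card)
      (fun c => (Finset.univ.filter fun q => loser ω ans q = c).card) K).card_le
      (side ω ans (block key i) i)
    right
    exact (Nat.mul_le_mul_left 30 hle).trans this

/-- Items in different blocks are in the right order up to an error of `4`. -/
def IsSorted {n : ℕ} (x : Fin n → ℝ) (key : Fin n → ℕ) : Prop :=
  ∀ a b, key a < key b → x a ≤ x b + 4

/-- Unless the draw is bad, the cuts preserve the order up to `4`, whatever the answers are. A cut by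
the number of wins is covered by `bad_of_misplaced` for `x`, and a cut by the number of losses by
the same lemma for `-x`, with winners and losers exchanged. -/
theorem IsSorted.refinedKey {n : ℕ} {x : Fin n → ℝ} {key : Fin n → ℕ} {K : ℕ}
    (hkey : IsSorted x key) {ω : Draw key K} {ans : Fin n × Fin K × Bool → Bool}
    (hans : ValidAnswers x (query ω) ans)
    (hω : ∀ a b, ¬ Bad (block key a) x K (pivot ω a) (edge ω) a b)
    (hω' : ∀ a b, ¬ Bad (block key a) (-x) K (pivot ω a) (edge ω) a b) :
    IsSorted x (refinedKey ω ans) := by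
  intro a b hab
  unfold AdvSort.refinedKey at hab
  have h2 := Bool.toNat_le (side ω ans (block key a) a)
  have h3 := Bool.toNat_le (side ω ans (block key b) b)
  rcases lt_or_ge (key a) (key b) with h | h
  · exact hkey a b h
  have hk : key a = key b := by omega
  rw [← block_eq hk] at hab h3
  have hsa : side ω ans (block key a) a = false := Bool.toNat_eq_zero.1 (by omega)
  have hsb : side ω ans (block key a) b = true := Bool.toNat_eq_one.1 (by omega)
  have haG : a ∈ block key a := mem_block.2 rfl
  have hbG : b ∈ block key a := mem_block.2 hk.symm
  by_contra hx
  push Not at hx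
  have hcard : 2 ≤ (block key a).card := by
    refine Finset.one_lt_card.2 ⟨a, haG, b, hbG, ?_⟩
    rintro rfl
    linarith
  have hpiv : ∀ c ∈ block key a, pivot ω c = pivot ω a := by
    intro c hc
    funext t
    unfold pivot
    rw [rep_eq (mem_block.1 hc)]
  have hp : ∀ t, pivot ω a t ∈ block key a := fun t =>
    mem_block.2 ((ω (rep key a, t)).1.2.trans (key_rep key a))
  have he : ∀ q, (edge ω q).1 ∈ block key a ↔ (edge ω q).2 ∈ block key a := by
    intro q
    rw [mem_block, mem_block]
    have h4 : key (edge ω q).1 = key q.1 := (ω q).2.1.2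
    have h5 : key (edge ω q).2 = key q.1 := (ω q).2.2.2
    rw [h4, h5]
  have hW : ∀ c ∈ block key a, ∀ t, ans (c, t, true) = true → x (pivot ω a t) ≤ x c + 1 := by
    intro c hc t h4
    by_contra h5
    have h6 := (hans (c, t, true)).2
    simp only [query, hpiv c hc, h4] at h6
    exact absurd (h6 (by linarith)) (by simp)
  have hW' : ∀ c ∈ block key a, ∀ t, ¬ ans (c, t, true) = true → x c ≤ x (pivot ω a t) + 1 := by
    intro c hc t h4
    by_contra h5
    have h6 := (hans (c, t, true)).1
    simp only [query, hpiv c hc] at h6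
    exact h4 (h6 (by linarith))
  have htrue : ∀ q : Fin n × Fin K, ans (q.1, q.2, false) = true →
      x (edge ω q).2 ≤ x (edge ω q).1 + 1 := by
    intro q h4
    by_contra h5
    have h6 := (hans (q.1, q.2, false)).2
    simp only [query, h4] at h6
    exact absurd (h6 (by linarith)) (by simp)
  have hfalse : ∀ q : Fin n × Fin K, ¬ ans (q.1, q.2, false) = true →
      x (edge ω q).1 ≤ x (edge ω q).2 + 1 := by
    intro q h4
    by_contra h5
    have h6 := (hans (q.1, q.2, false)).1
    simp only [query] at h6
    exact h4 (h6 (by linarith))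
  have hsplit := (isSplit_splitBit hcard (score ans)
    (fun c => (Finset.univ.filter fun q => winner ω ans q = c).card)
    (fun c => (Finset.univ.filter fun q => loser ω ans q = c).card) K).order a haG b hbG hsa hsb
  rcases hsplit with hlt | ⟨heq, hs, hf⟩ | ⟨heq, hs, hf⟩
  · refine absurd hlt (not_lt.2 (Finset.card_le_card fun t ht => ?_))
    simp only [Finset.mem_filter, Finset.mem_univ, true_and] at ht ⊢
    by_contra h4
    have := hW b hbG t ht
    have := hW' a haG t h4
    linarith
  · refine hω a b (bad_of_misplaced (win := winner ω ans)
      (W := fun c t => ans (c, t, true) = true) hp he hW hW' (fun q => ?_) haG hbG hx heq hs hf)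
    unfold winner
    split_ifs with h4
    · exact Or.inl ⟨rfl, htrue q h4⟩
    · exact Or.inr ⟨rfl, hfalse q h4⟩
  · have hcompl : ∀ c, (Finset.univ.filter fun t => ¬ ans (c, t, true) = true).card +
        score ans c = K := by
      intro c
      have := Finset.card_filter_add_card_filter_not (s := (Finset.univ : Finset (Fin K)))
        (fun t => ans (c, t, true) = true)
      rw [Finset.card_univ, Fintype.card_fin] at this
      unfold score
      omega
    have h4 := hcompl a
    have h5 := hcompl b
    rw [block_eq hk] at *
    refine hω' b a (bad_of_misplaced (win := loser ω ans)
      (W := fun c t => ¬ ans (c, t, true) = true) (fun t => ?_) he (fun c hc t h => ?_)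
      (fun c hc t h => ?_) (fun q => ?_) hbG haG (by simp only [Pi.neg_apply]; linarith)
      (by omega) (by omega) hf)
    · rw [hpiv b hbG]; exact hp t
    · have := hW' c hc t h
      simp only [Pi.neg_apply, hpiv b hbG]
      linarith
    · have := hW c hc t (not_not.1 h)
      simp only [Pi.neg_apply, hpiv b hbG]
      linarith
    · unfold loser
      simp only [Pi.neg_apply]
      split_ifs with h6
      · exact Or.inr ⟨rfl, by linarith [htrue q h6]⟩
      · exact Or.inl ⟨rfl, by linarith [hfalse q h6]⟩

/-! ### The whole algorithm -/

/-- The algorithm with `L` levels left: draw, ask, cut every block, and go on. In the end the items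
are sorted by the position of their block. -/
noncomputable def sortLevels {n : ℕ} (K : ℕ) : ℕ → (Fin n → ℕ) → SortAlg n
  | 0, key => .output (Tuple.sort key)
  | L + 1, key => sample (Draw key K) fun ω => ask (query ω) fun ans =>
      sortLevels K L (refinedKey ω ans)

theorem maxRounds_sortLevels_le {n : ℕ} (K L : ℕ) (key : Fin n → ℕ) :
    (sortLevels K L key).maxRounds ≤ L := by
  induction L generalizing key with
  | zero => exact le_rfl
  | succ L ih =>
    exact (maxRounds_sample_le (Ω := Draw key K) fun ω =>
      maxRounds_ask_le (query := query ω) fun ans => ih _).trans_eq (add_comm 1 L)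

theorem maxComparisons_sortLevels_le {n : ℕ} (K L : ℕ) (key : Fin n → ℕ) :
    (sortLevels K L key).maxComparisons ≤ L * (n * (K * 2)) := by
  induction L generalizing key with
  | zero => exact Nat.zero_le _
  | succ L ih =>
    refine (maxComparisons_sample_le (Ω := Draw key K) fun ω =>
      maxComparisons_ask_le (query := query ω) fun ans => ih _).trans_eq ?_
    simp only [Fintype.card_prod, Fintype.card_fin, Fintype.card_bool]
    ring

theorem isApproxSorting_sort {n : ℕ} {x : Fin n → ℝ} {key : Fin n → ℕ} (hkey : IsSorted x key)
    (hinj : Function.Injective key) : IsApproxSorting 4 x (Tuple.sort key) := by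
  intro p q hpq
  have h1 : key (Tuple.sort key p) ≤ key (Tuple.sort key q) := Tuple.monotone_sort key hpq.le
  have h2 : key (Tuple.sort key p) ≠ key (Tuple.sort key q) := fun h =>
    hpq.ne ((Tuple.sort key).injective (hinj h))
  have := hkey _ _ (lt_of_le_of_ne h1 h2)
  unfold GeApprox
  linarith

open Classical in
theorem card_exists_bad_le {n : ℕ} (key : Fin n → ℕ) (K : ℕ) (x : Fin n → ℝ) :
    ((Finset.univ.filter fun ω : Draw key K =>
      ∃ a b, Bad (block key a) x K (pivot ω a) (edge ω) a b).card : ℝ) ≤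
      4 * n ^ 2 * Real.exp (-(K / 2500)) * Fintype.card (Draw key K) := by
  have hsub : (Finset.univ.filter fun ω : Draw key K =>
      ∃ a b, Bad (block key a) x K (pivot ω a) (edge ω) a b) ⊆
      Finset.univ.biUnion fun ab : Fin n × Fin n => Finset.univ.filter fun ω : Draw key K =>
        Bad (block key ab.1) x K (pivot ω ab.1) (edge ω) ab.1 ab.2 := by
    intro ω hω
    obtain ⟨a, b, h⟩ := (Finset.mem_filter.1 hω).2
    exact Finset.mem_biUnion.2 ⟨(a, b), Finset.mem_univ _,
      Finset.mem_filter.2 ⟨Finset.mem_univ _, h⟩⟩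
  have h1 := (Nat.cast_le (α := ℝ)).2 ((Finset.card_le_card hsub).trans Finset.card_biUnion_le)
  refine h1.trans ?_
  push_cast
  refine (Finset.sum_le_sum fun ab _ => card_bad_le key K x ab.1 ab.2).trans (le_of_eq ?_)
  simp only [Finset.sum_const, Finset.card_univ, Fintype.card_prod, Fintype.card_fin,
    nsmul_eq_mul]
  push_cast
  ring

/-- The errors of the `L` levels add up. The bound on the size of the blocks makes them singletons
in the end. -/
theorem run_sortLevels_le {n : ℕ} {x : Fin n → ℝ} {A : Strategy n}
    (hA : A.IsAdversarialComparator x) (K L : ℕ) (key : Fin n → ℕ) (h : List (RoundRecord n))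
    (hkey : IsSorted x key)
    (hcard : ∀ i, ((block key i).card : ℝ) ≤ (30 / 29) ^ L) :
    ((sortLevels K L key).run A h).toOuterMeasure {σ | ¬ IsApproxSorting 4 x σ} ≤
      ENNReal.ofReal (L * (8 * n ^ 2 * Real.exp (-(K / 2500)))) := by
  classical
  induction L generalizing key h with
  | zero =>
    have hinj : Function.Injective key := by
      intro a b hab
      have h1 := hcard b
      rw [pow_zero] at h1
      exact Finset.card_le_one.1 (by exact_mod_cast h1) a (mem_block.2 hab) b (mem_block.2 rfl)
    have h2 := isApproxSorting_sort hkey hinj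
    unfold sortLevels SortAlg.run
    rw [PMF.toOuterMeasure_pure_apply, if_neg (by simpa using h2)]
    exact zero_le
  | succ L ih =>
    have hδ : (0 : ℝ) ≤ 8 * n ^ 2 * Real.exp (-(K / 2500)) := by positivity
    rw [show ((L + 1 : ℕ) : ℝ) * (8 * n ^ 2 * Real.exp (-(K / 2500))) =
      8 * n ^ 2 * Real.exp (-(K / 2500)) + L * (8 * n ^ 2 * Real.exp (-(K / 2500))) by
        push_cast; ring]
    refine run_sample_le A h
      ((Finset.univ.filter fun ω : Draw key K =>
        ∃ a b, Bad (block key a) x K (pivot ω a) (edge ω) a b) ∪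
      (Finset.univ.filter fun ω : Draw key K =>
        ∃ a b, Bad (block key a) (-x) K (pivot ω a) (edge ω) a b)) hδ (by positivity) ?_
      fun ω hω => ?_
    · refine (Nat.cast_le.2 (Finset.card_union_le _ _)).trans ?_
      have h1 := card_exists_bad_le key K x
      have h2 := card_exists_bad_le key K (-x)
      push_cast
      linarith
    · simp only [Finset.mem_union, Finset.mem_filter, Finset.mem_univ, true_and, not_or,
        not_exists] at hω
      refine run_ask_le hA h fun ans hans h' => ih _ h' (hkey.refinedKey hans hω.1 hω.2) fun i => ?_
      rcases card_block_refinedKey ω ans i with h1 | h1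
      · calc ((block (refinedKey ω ans) i).card : ℝ) ≤ 1 := by exact_mod_cast h1
          _ ≤ (30 / 29) ^ L := one_le_pow₀ (by norm_num)
      · have h2 : (30 : ℝ) * (block (refinedKey ω ans) i).card ≤ 29 * (block key i).card := by
          exact_mod_cast h1
        have h3 := hcard i
        rw [pow_succ] at h3
        linarith

theorem lt_successProb_of_lt {n : ℕ} {alg : SortAlg n} {A : Strategy n} {k ε δ : ℝ}
    {x : Fin n → ℝ} (hε : 0 ≤ ε) (hδ : ε < δ)
    (h : (alg.run A []).toOuterMeasure {σ | ¬ IsApproxSorting k x σ} ≤ ENNReal.ofReal ε) :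
    1 - δ < alg.successProb A k x := by
  set p := alg.run A []
  set S := {σ | IsApproxSorting k x σ}
  have h1 : p.toOuterMeasure S + p.toOuterMeasure Sᶜ = 1 := by
    rw [PMF.toOuterMeasure_apply, PMF.toOuterMeasure_apply, ← ENNReal.tsum_add, ← p.tsum_coe]
    exact tsum_congr fun σ => congr_fun (Set.indicator_self_add_compl S p) σ
  have h2 : p.toOuterMeasure Sᶜ ≤ ENNReal.ofReal ε := h
  have hS : p.toOuterMeasure S ≠ ⊤ := fun h' => by simp [h'] at h1
  have hSc : p.toOuterMeasure Sᶜ ≠ ⊤ := fun h' => by simp [h'] at h1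
  have h3 := congr_arg ENNReal.toReal h1
  rw [ENNReal.toReal_add hS hSc, ENNReal.toReal_one] at h3
  have h4 : (p.toOuterMeasure Sᶜ).toReal ≤ ε := ENNReal.toReal_le_of_le_ofReal hε h2
  change 1 - δ < (p.toOuterMeasure S).toReal
  linarith

theorem clog_mul_log_two_le {n : ℕ} (hn : 1 ≤ n) :
    (Nat.clog 2 n : ℝ) * Real.log 2 ≤ 2 * Real.log n := by
  rcases hn.eq_or_lt with rfl | hn
  · simp
  have h1 := Nat.pow_pred_clog_lt_self one_lt_two hn
  have hpos : 0 < Nat.clog 2 n := Nat.clog_pos one_lt_two hn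
  have h2 : ((Nat.clog 2 n).pred : ℝ) * Real.log 2 ≤ Real.log n := by
    rw [← Real.log_pow]
    exact Real.log_le_log (by positivity) (by exact_mod_cast h1.le)
  have h3 : Real.log 2 ≤ Real.log n := Real.log_le_log (by norm_num) (by exact_mod_cast hn)
  have h4 : ((Nat.clog 2 n).pred : ℝ) + 1 = Nat.clog 2 n := by
    exact_mod_cast Nat.succ_pred_eq_of_pos hpos
  rw [← h4]
  linarith

end AdvSort

open AdvSort in
theorem theorem1p1 :
    ∃ (alg : (n : ℕ) → AdvSort.SortAlg n) (C : ℝ), 0 < C ∧ ∀ n : ℕ, 1 ≤ n →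
      ((alg n).maxComparisons : ℝ) ≤ C * ((n : ℝ) * Real.log n ^ 2) ∧
      ((alg n).maxRounds : ℝ) ≤ C * Real.log n ∧
      ∀ (x : Fin n → ℝ) (A : AdvSort.Strategy n), A.IsAdversarialComparator x →
        1 - 1 / (n : ℝ) ^ 2 < (alg n).successProb A 4 x := by
  refine ⟨fun n => sortLevels (32500 * Nat.clog 2 n) (21 * Nat.clog 2 n) fun _ => 0,
    21 * 65000 * 16, by norm_num, fun n hn => ?_⟩
  -- `Nat.clog 2 1 = 0`, so a single item is returned without any comparison.
  have hlog : (Nat.clog 2 n : ℝ) ≤ 4 * Real.log n := by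
    have h1 := clog_mul_log_two_le hn
    have h2 : (1 / 2 : ℝ) ≤ Real.log 2 := by linarith [Real.log_two_gt_d9]
    have h3 : (0 : ℝ) ≤ Nat.clog 2 n := Nat.cast_nonneg _
    nlinarith
  have hlog0 : 0 ≤ Real.log n := Real.log_nonneg (by exact_mod_cast hn)
  refine ⟨?_, ?_, fun x A hA => ?_⟩
  · have h1 : ((sortLevels (32500 * Nat.clog 2 n) (21 * Nat.clog 2 n)
        fun _ : Fin n => 0).maxComparisons : ℝ) ≤
        21 * 65000 * (n * (Nat.clog 2 n : ℝ) ^ 2) := by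
      refine (Nat.cast_le.2 (maxComparisons_sortLevels_le _ _ _)).trans (le_of_eq ?_)
      push_cast
      ring
    have h2 : (Nat.clog 2 n : ℝ) ^ 2 ≤ (4 * Real.log n) ^ 2 :=
      pow_le_pow_left₀ (Nat.cast_nonneg _) hlog 2
    have h3 : (n : ℝ) * (Nat.clog 2 n : ℝ) ^ 2 ≤ n * (4 * Real.log n) ^ 2 :=
      mul_le_mul_of_nonneg_left h2 (Nat.cast_nonneg _)
    linarith
  · refine (Nat.cast_le.2 (maxRounds_sortLevels_le _ _ _)).trans ?_
    push_cast
    linarith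
  · refine lt_successProb_of_lt (by positivity) ?_
      (run_sortLevels_le hA _ _ _ _ (fun a b h => absurd h (lt_irrefl _)) fun i => ?_)
    -- One level fails with probability at most `8 * n ^ 2 / 2 ^ (13 * m)`, and `n ≤ 2 ^ m`.
    · set m := Nat.clog 2 n with hm
      have hnm : (n : ℝ) ≤ 2 ^ m := by exact_mod_cast Nat.le_pow_clog one_lt_two n
      have hn0 : (0 : ℝ) < n := by exact_mod_cast hn
      have hexp : Real.exp (-((32500 * m : ℕ) / 2500 : ℝ)) ≤ ((2 : ℝ) ^ (13 * m))⁻¹ := by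
        rw [Real.exp_neg]
        refine inv_anti₀ (by positivity) ?_
        have h2 : (2 : ℝ) ≤ Real.exp 1 := by linarith [Real.add_one_le_exp (1 : ℝ)]
        calc (2 : ℝ) ^ (13 * m) ≤ Real.exp 1 ^ (13 * m) := pow_le_pow_left₀ (by norm_num) h2 _
          _ = Real.exp ((32500 * m : ℕ) / 2500 : ℝ) := by
            rw [← Real.exp_nat_mul]
            congr 1
            push_cast
            ring
      have hn4 : (n : ℝ) ^ 4 ≤ 2 ^ (4 * m) := by
        rw [mul_comm, pow_mul]
        exact pow_le_pow_left₀ hn0.le hnm 4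
      have hm2 : (168 : ℝ) * m < 2 ^ (9 * m) := by
        have h3 : ∀ k : ℕ, 168 * k < 2 ^ (9 * k) := by
          intro k
          induction k with
          | zero => simp
          | succ k ih =>
            have : 1 ≤ 2 ^ (9 * k) := Nat.one_le_two_pow
            rw [mul_add 9, pow_add]
            omega
        exact_mod_cast h3 m
      rw [lt_div_iff₀ (by positivity)]
      calc ((21 * m : ℕ) : ℝ) * (8 * n ^ 2 * Real.exp (-((32500 * m : ℕ) / 2500 : ℝ))) * n ^ 2
          = 168 * m * (n ^ 4 * Real.exp (-((32500 * m : ℕ) / 2500 : ℝ))) := by push_cast; ring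
        _ ≤ 168 * m * (2 ^ (4 * m) * ((2 : ℝ) ^ (13 * m))⁻¹) := by gcongr
        _ < 2 ^ (9 * m) * (2 ^ (4 * m) * ((2 : ℝ) ^ (13 * m))⁻¹) :=
            mul_lt_mul_of_pos_right hm2 (by positivity)
        _ = 1 := by
            rw [← mul_assoc, ← pow_add, show 9 * m + 4 * m = 13 * m by ring]
            exact mul_inv_cancel₀ (by positivity)
    · have h1 : ((block (fun _ : Fin n => 0) i).card : ℝ) ≤ n := by
        exact_mod_cast (Finset.card_le_univ _).trans_eq (Fintype.card_fin n)
      refine h1.trans ((show (n : ℝ) ≤ 2 ^ Nat.clog 2 n by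
        exact_mod_cast Nat.le_pow_clog one_lt_two n).trans ?_)
      -- `21` levels halve the blocks, since `2 ≤ (30 / 29) ^ 21`.
      rw [pow_mul]
      exact pow_le_pow_left₀ (by norm_num) (by norm_num) _
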